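/- **Theorem (I-CGM with the SVRG estimator).** Let $1\le m\le n$, let $f_1,\dots,f_n:\mathbb R^d\to\mathbb R$ be differentiable, $f=\frac1n\sum_{i=1}^n f_i$ be bounded from below, $h_i:=f-f_i$, $x^0\in\mathbb R^d$ and $F^0:=f(x^0)-\inf f$. Suppose that for some $\Delta_1,\delta>0$ and all $x,y\in\mathbb R^d$ $$\|\nabla h_1(x)-\nabla h_1(y)\|\le\Delta_1\|x-y\|,\qquad \frac1n\sum_{i=1}^n\|\nabla h_i(x)-\nabla h_i(y)\|^2\le\delta^2\|x-y\|^2 .$$ Put $n_m=\frac nm$, $q_m=\frac{n-m}{n-1}$ (with $q_m=0$ if $n=1$), $\delta_m=\sqrt{q_m/m}\,\delta$, and let $p_B\in(0,1]$, $\varepsilon>0$, $$\lambda=3\Delta_1+\frac{16\,\delta_m}{p_B},\qquad T=\Big\lceil \frac{256\,(\Delta_1+6\delta_m/p_B)\,F^0}{\varepsilon^2}\Big\rceil .$$ *The method.* For $t\ge1$, once $x^t$ has been computed, a set $S_t$ is drawn uniformly from the $m$-element subsets of $[n]$ and a coin $\omega_t\in\{0,1\}$ with $P(\omega_t=1)=p_B$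 is tossed, independently of each other and jointly independent of everything generated so far. The reference points are $w^0=x^0$ and, for $t\ge1$, $w^t=x^t$ if $\omega_t=1$ and $w^t=w^{t-1}$ otherwise. The gradient estimates are $g^0=\nabla f(x^0)$ and, for $t\ge1$, $$g^t=\nabla f_{S_t}(x^t)+\nabla f(w^t)-\nabla f_{S_t}(w^t),\qquad f_S:=\frac1m\sum_{i\in S}f_i .$$ The next iterate $x^{t+1}$ is an approximate minimizer, obtained by a possibly randomized procedure, of $$F_t(x)=f_1(x)+h_1(x^t)+\langle g^t-\nabla f_1(x^t),x-x^t\rangle+\frac\lambda2\|x-x^t\|^2 .$$ The subproblems of the first $T$ iterations are assumed to be solved so accurately that $F_t(x^{t+1})\le F_t(x^t)$ almost surely for $0\le t<T$ and $$\sum_{t=0}^{T-1}\mathbb E\|\nabla F_t(x^{t+1})\|^2\le\frac{(\lambda+\Delta_1)^2}{\lambda-\Delta_1}F^0+\sum_{t=0}^{T-1}\mathbb E\|g^t-\nabla f(x^t)\|^2 .$$ *Communication.* A communication round contacts at most $m$ clients. It costs $C_A$ if these are chosen arbitrarily, $C_R$ if they are a uniformly random $m$-element set, and $1$ if only the delegate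 client $1$ is contacted, where $1\le C_R\le C_A$. A full gradient is computed by $\lceil n_m\rceil$ arbitrary-selection rounds. The method makes one full synchronization at $x^0$; then iteration $t=0,\dots,T-1$ uses, if $t\ge1$, one random-selection round with the clients in $S_t$, and a full synchronization at $w^t$ if $\omega_t=1$, and, for every $t$, one round with the delegate client, which solves the subproblem. The communication complexity is $\mathbb E[C_AN_A+C_RN_R+N_D]$, where $N_A,N_R,N_D$ are the total numbers of arbitrary-selection, random-selection and delegate rounds. *Conclusion.* 1. If $T\ge1$ and $\bar x^T$ is sampled uniformly from $(x^t)_{t=1}^T$, independently of the iterates, then $\mathbb E\|\nabla f(\bar x^T)\|^2\le\varepsilon^2$. 2. If moreover $p_B=\dfrac{C_R}{C_A\lceil n_m\rceil}$, then the communication complexity of the $T$ iterations is at most $$C_A\lceil n_m\rceil+(2C_R+1)\Big\lceil\frac{256\,\big(\Delta_1+6\,\delta_m C_A\lceil n_m\rceil/C_R\big)F^0}{\varepsilon^2}\Big\rceil .$$ -/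

import Mathlib

open MeasureTheory ProbabilityTheory
open scoped ENNReal

noncomputable section

namespace FedOpt

/-- The space `ℝ^d` with its Euclidean norm. -/
abbrev Vec (d : ℕ) := EuclideanSpace ℝ (Fin d)

section Problem

variable {n d : ℕ}

/-- The global objective `f = (1/n) ∑ i, f_i`. -/
def avg (f : Fin n → Vec d → ℝ) (x : Vec d) : ℝ := (1 / (n : ℝ)) * ∑ i, f i x

/-- The minibatch objective `f_S = (1/m) ∑ i ∈ S, f_i`, for a set `S` of `m` clients. -/
def batchAvg (f : Fin n → Vec d → ℝ) (m : ℕ) (S : Finset (Fin n)) (x : Vec d) : ℝ :=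
  (1 / (m : ℝ)) * ∑ i ∈ S, f i x

/-- The difference function `h_i = f - f_i`. -/
def diffFn (f : Fin n → Vec d → ℝ) (i : Fin n) (x : Vec d) : ℝ := avg f x - f i x

/-- The initial gap `F⁰ = f(x⁰) - inf f` (used for `f` bounded from below). -/
def gap (f : Fin n → Vec d → ℝ) (x₀ : Vec d) : ℝ := avg f x₀ - ⨅ x, avg f x

/-- First-order dissimilarity of the delegate client: `∇h_1` is `Δ₁`-Lipschitz.
The delegate client is the one with index `0`. -/
def DelegateSimilar [NeZero n] (f : Fin n → Vec d → ℝ) (Δ₁ : ℝ) : Prop :=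
  ∀ x y, ‖gradient (diffFn f 0) x - gradient (diffFn f 0) y‖ ≤ Δ₁ * ‖x - y‖

/-- Average dissimilarity of the clients with constant `δ`. -/
def AverageSimilar (f : Fin n → Vec d → ℝ) (δ : ℝ) : Prop :=
  ∀ x y, (1 / (n : ℝ)) * ∑ i, ‖gradient (diffFn f i) x - gradient (diffFn f i) y‖ ^ 2
    ≤ δ ^ 2 * ‖x - y‖ ^ 2

/-- `δ_m = √(q_m / m) δ` with `q_m = (n - m) / (n - 1)`; for `n = m = 1` the quotient
`0 / 0` is `0`, which is the right value, since then nothing is random. -/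
def deltaM (n m : ℕ) (δ : ℝ) : ℝ :=
  Real.sqrt ((((n : ℝ) - m) / ((n : ℝ) - 1)) / m) * δ

/-- `⌈n_m⌉ = ⌈n / m⌉`, the number of rounds of one full synchronization. -/
def syncRounds (n m : ℕ) : ℕ := ⌈(n : ℝ) / m⌉₊

/-- The model of the objective at the point `x` with gradient estimate `g`: the function
`y ↦ f_1(y) + h_1(x) + ⟨g - ∇f_1(x), y - x⟩ + (lam/2) ‖y - x‖²`. -/
def model [NeZero n] (f : Fin n → Vec d → ℝ) (lam : ℝ) (x g : Vec d) (y : Vec d) : ℝ :=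
  f 0 y + diffFn f 0 x + inner ℝ (g - gradient (f 0) x) (y - x) + lam / 2 * ‖y - x‖ ^ 2

end Problem

section Estimator

variable {n d : ℕ} {Ω : Type*}

/-- The reference points `w^t` of the loopless SVRG estimator: `w^0 = x^0`, and for `t ≥ 1`,
`w^t = x^t` if the coin `b_t` shows `true` and `w^t = w^{t-1}` otherwise. -/
def refPoint (x : ℕ → Ω → Vec d) (b : ℕ → Ω → Bool) : ℕ → Ω → Vec d
  | 0, ω => x 0 ω
  | t + 1, ω => if b (t + 1) ω then x (t + 1) ω else refPoint x b t ω

/-- The loopless SVRG estimator: `∇f(x^0)` at `t = 0`, and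
`∇f_{S_t}(x^t) + ∇f(w^t) - ∇f_{S_t}(w^t)` at `t ≥ 1`. -/
def svrg (f : Fin n → Vec d → ℝ) (m : ℕ) (x : ℕ → Ω → Vec d)
    (S : ℕ → Ω → Finset (Fin n)) (b : ℕ → Ω → Bool) : ℕ → Ω → Vec d
  | 0, ω => gradient (avg f) (x 0 ω)
  | t + 1, ω =>
      gradient (batchAvg f m (S (t + 1) ω)) (x (t + 1) ω)
        + gradient (avg f) (refPoint x b (t + 1) ω)
        - gradient (batchAvg f m (S (t + 1) ω)) (refPoint x b (t + 1) ω)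

/-- The probabilistic structure of a run. The σ-algebra `𝓕 t` is the information available when
`x^t` has been computed (and may contain the randomness of the local solvers). For `t ≥ 1`, the set
`S_t` is uniform among the `m`-element sets of clients, the coin `b_t` is Bernoulli with
parameter `p`, they are independent of each other, and jointly independent of `𝓕 t`. -/
structure IsRun [mΩ : MeasurableSpace Ω] (μ : Measure Ω) (m : ℕ) (p : ℝ) (x₀ : Vec d)
    (𝓕 : Filtration ℕ mΩ) (x : ℕ → Ω → Vec d) (S : ℕ → Ω → Finset (Fin n))
    (b : ℕ → Ω → Bool) : Prop where
  init : ∀ ω, x 0 ω = x₀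
  adapted : ∀ t, Measurable[𝓕 t] (x t)
  set_known : ∀ t, 1 ≤ t → MeasurableSpace.comap (S t) ⊤ ≤ 𝓕 (t + 1)
  coin_known : ∀ t, 1 ≤ t → MeasurableSpace.comap (b t) ⊤ ≤ 𝓕 (t + 1)
  set_uniform : ∀ t, 1 ≤ t → ∀ A : Finset (Fin n), A.card = m →
    μ {ω | S t ω = A} = ((n.choose m : ℕ) : ℝ≥0∞)⁻¹
  coin_bernoulli : ∀ t, 1 ≤ t → μ {ω | b t ω = true} = ENNReal.ofReal p
  set_indep_coin : ∀ t, 1 ≤ t →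
    Indep (MeasurableSpace.comap (S t) ⊤) (MeasurableSpace.comap (b t) ⊤) μ
  fresh : ∀ t, 1 ≤ t →
    Indep (MeasurableSpace.comap (S t) ⊤ ⊔ MeasurableSpace.comap (b t) ⊤) (𝓕 t) μ

/-- The accuracy condition for the subproblems of the first `T` iterations, where `g t` is the
gradient estimate at iteration `t` and `F_t = model f lam (x^t) (g^t)`. Almost surely
`F_t(x^{t+1}) ≤ F_t(x^t)`, and
`∑_{t<T} E‖∇F_t(x^{t+1})‖² ≤ (lam+Δ₁)²/(lam-Δ₁) F⁰ + ∑_{t<T} E‖g^t - ∇f(x^t)‖²`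
(expectations of nonnegative quantities, in `[0, ∞]`). -/
def SubproblemsAccurate [NeZero n] [MeasurableSpace Ω] (μ : Measure Ω) (f : Fin n → Vec d → ℝ)
    (Δ₁ lam : ℝ) (x₀ : Vec d) (x g : ℕ → Ω → Vec d) (T : ℕ) : Prop :=
  (∀ t < T, ∀ᵐ ω ∂μ,
    model f lam (x t ω) (g t ω) (x (t + 1) ω) ≤ model f lam (x t ω) (g t ω) (x t ω)) ∧
  ∑ t ∈ Finset.range T,
      ∫⁻ ω, ‖gradient (model f lam (x t ω) (g t ω)) (x (t + 1) ω)‖ₑ ^ 2 ∂μ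
    ≤ ENNReal.ofReal ((lam + Δ₁) ^ 2 / (lam - Δ₁) * gap f x₀)
      + ∑ t ∈ Finset.range T, ∫⁻ ω, ‖g t ω - gradient (avg f) (x t ω)‖ₑ ^ 2 ∂μ

end Estimator

section Communication

/-- The client-selection strategies: arbitrary, random and delegated. -/
inductive Strategy
  | arbitrary
  | random
  | delegated
  deriving DecidableEq

/-- A communication round: how the clients were selected, which clients were contacted, and the
vectors that the server sends to them. -/
structure Round (n d : ℕ) where
  strategy : Strategy
  clients : Finset (Fin n)
  message : List (Vec d)

variable {n d : ℕ} {Ω : Type*}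

/-- How often the strategy `s` is used in a list of rounds. -/
def uses (s : Strategy) (R : List (Round n d)) : ℕ := R.countP (fun r => r.strategy = s)

/-- The communication complexity `E[C_A N_A + C_R N_R + N_D]` of a random list of rounds. -/
def commComplexity [MeasurableSpace Ω] (μ : Measure Ω) (CA CR : ℝ)
    (R : Ω → List (Round n d)) : ℝ≥0∞ :=
  ∫⁻ ω, ENNReal.ofReal (CA * uses .arbitrary (R ω) + CR * uses .random (R ω)
    + uses .delegated (R ω)) ∂μ

/-- The `k`-th group of clients in the splitting of `[n]` into `⌈n/m⌉` consecutive groups of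
at most `m` clients. -/
def group (n m k : ℕ) : Finset (Fin n) := Finset.univ.filter (fun i => i.val / m = k)

/-- Full synchronization at `w`: each group of clients is contacted in one arbitrary-selection
round and sent `w` (each client `i` returns `∇f_i(w)`). -/
def fullSync (n m : ℕ) (w : Vec d) : List (Round n d) :=
  (List.range (syncRounds n m)).map (fun k => ⟨.arbitrary, group n m k, [w]⟩)

/-- The rounds of iteration `t`. For `t ≥ 1`, one random-selection round in which the clients in
`S_t` are sent `x^t` and `w^t`, and a full synchronization at `w^t` if the coin shows `true`. Then,
for every `t`, one round with the delegate client, which is sent `x^t` and `g^t` and solves the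
subproblem. The gradient at `x^0` is obtained before iteration `0`. -/
def iterationRounds [NeZero n] (m : ℕ) (x g : ℕ → Ω → Vec d) (S : ℕ → Ω → Finset (Fin n))
    (b : ℕ → Ω → Bool) (t : ℕ) (ω : Ω) : List (Round n d) :=
  (if t = 0 then [] else
    ⟨.random, S t ω, [x t ω, refPoint x b t ω]⟩
      :: (if b t ω then fullSync n m (refPoint x b t ω) else []))
  ++ [⟨.delegated, {0}, [x t ω, g t ω]⟩]

/-- All rounds of `T` iterations: the initial full synchronization at `x^0`, followed by the rounds
of the iterations `0, …, T - 1`. -/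
def runRounds [NeZero n] (m : ℕ) (x g : ℕ → Ω → Vec d) (S : ℕ → Ω → Finset (Fin n))
    (b : ℕ → Ω → Bool) (T : ℕ) (ω : Ω) : List (Round n d) :=
  fullSync n m (x 0 ω) ++ (List.range T).flatMap (fun t => iterationRounds m x g S b t ω)

end Communication

end FedOpt

end

/-! Write `f = f_1 + h_1`. The model keeps `f_1` exactly and linearises `h_1`, whose gradient is
`Δ₁`-Lipschitz, so any step that does not increase the model decreases `f` by `(lam-Δ₁)/4
‖x^{t+1}-x^t‖²`, up to `‖g^t-∇f(x^t)‖²/(lam-Δ₁)` (`avg_le_of_model_le`). What remains is to control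
the estimation error by the step lengths.

The error vanishes when the coin moves the reference point to `x^t`. Otherwise it is minus the mean
over `S_t` of the vectors `∇h_i(x^t)-∇h_i(w^{t-1})`, which sum to zero over all clients. Sampling
without replacement gives the variance factor `δ_m²` (`sum_powersetCard_error_le`), hence `E‖error‖²
≤ δ_m² E‖x^t-w^t‖²` (`IsRun.lintegral_svrg_error_le`). The distance to the reference point contracts
by `1-p/2` per iteration, plus `2/p` times the squared step
(`IsRun.lintegral_refPoint_dist_succ_le`), so the summed error is at most `(2δ_m/p)²` times the
summed squared steps. The choice of `lam` makes `lam-Δ₁ ≥ 16δ_m/p`, and the descent absorbs the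
error.

Finally `∇f(x^{t+1})` is bounded by the model gradient, the estimation error and the step, all three
now summable (`sum_le_of_recursions`). For the communication bound, the chosen `p` makes the
expected cost of a synchronization after the initial one equal to `C_R`. -/

namespace FedOpt

/-! ### Gradients of averages, difference functions and models -/

section Deterministic

variable {n d : ℕ}

lemma hasGradientAt_mul_sum {f : Fin n → Vec d → ℝ} (hf : ∀ i, Differentiable ℝ (f i)) (c : ℝ)
    (s : Finset (Fin n)) (x : Vec d) :
    HasGradientAt (fun x => c * ∑ i ∈ s, f i x) (c • ∑ i ∈ s, gradient (f i) x) x := by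
  have h : HasFDerivAt (fun x => c * ∑ i ∈ s, f i x) (c • ∑ i ∈ s, fderiv ℝ (f i) x) x :=
    (HasFDerivAt.fun_sum fun i _ => (hf i x).hasFDerivAt).const_mul c
  rw [hasGradientAt_iff_hasFDerivAt]
  simpa [map_sum, toDual_gradient] using h

lemma gradient_avg {f : Fin n → Vec d → ℝ} (hf : ∀ i, Differentiable ℝ (f i)) (x : Vec d) :
    gradient (avg f) x = (1 / (n : ℝ)) • ∑ i, gradient (f i) x :=
  (hasGradientAt_mul_sum hf _ _ x).gradient

lemma gradient_batchAvg {f : Fin n → Vec d → ℝ} (hf : ∀ i, Differentiable ℝ (f i)) (m : ℕ)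
    (s : Finset (Fin n)) (x : Vec d) :
    gradient (batchAvg f m s) x = (1 / (m : ℝ)) • ∑ i ∈ s, gradient (f i) x :=
  (hasGradientAt_mul_sum hf _ _ x).gradient

lemma differentiable_avg {f : Fin n → Vec d → ℝ} (hf : ∀ i, Differentiable ℝ (f i)) :
    Differentiable ℝ (avg f) :=
  fun x => (hasGradientAt_mul_sum hf _ _ x).differentiableAt

lemma hasGradientAt_diffFn {f : Fin n → Vec d → ℝ} (hf : ∀ i, Differentiable ℝ (f i)) (i : Fin n)
    (x : Vec d) :
    HasGradientAt (diffFn f i) (gradient (avg f) x - gradient (f i) x) x := by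
  rw [hasGradientAt_iff_hasFDerivAt, map_sub, toDual_gradient, toDual_gradient]
  exact (differentiable_avg hf x).hasFDerivAt.sub (hf i x).hasFDerivAt

lemma gradient_diffFn {f : Fin n → Vec d → ℝ} (hf : ∀ i, Differentiable ℝ (f i)) (i : Fin n)
    (x : Vec d) :
    gradient (diffFn f i) x = gradient (avg f) x - gradient (f i) x :=
  (hasGradientAt_diffFn hf i x).gradient

lemma gradient_model [NeZero n] {f : Fin n → Vec d → ℝ} (hf : ∀ i, Differentiable ℝ (f i))
    (lam : ℝ) (x g y : Vec d) :
    gradient (model f lam x g) y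
      = gradient (f 0) y + (g - gradient (f 0) x) + lam • (y - x) := by
  apply HasGradientAt.gradient
  rw [hasGradientAt_iff_hasFDerivAt, map_add, map_add, toDual_gradient]
  have hid : HasFDerivAt (fun y : Vec d => y - x) (ContinuousLinearMap.id ℝ (Vec d)) y :=
    (hasFDerivAt_id y).sub_const x
  have h2 := (hasFDerivAt_const (g - gradient (f 0) x) y).inner ℝ hid
  have h3 := (hid.norm_sq).const_mul (lam / 2)
  have h := (((hf 0 y).hasFDerivAt.add_const (diffFn f 0 x)).add h2).add h3
  refine h.congr_fderiv ?_
  ext v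
  simp [inner_sub_left]
  ring

/-! ### Pathwise inequalities for one inexact step -/

/-- The descent lemma for a function with Lipschitz gradient. -/
lemma le_add_inner_gradient {E : Type*} [NormedAddCommGroup E] [InnerProductSpace ℝ E]
    [CompleteSpace E] {h : E → ℝ} (hh : Differentiable ℝ h) {L : ℝ}
    (hL : ∀ x y, ‖gradient h x - gradient h y‖ ≤ L * ‖x - y‖) (x y : E) :
    h y ≤ h x + inner ℝ (gradient h x) (y - x) + L / 2 * ‖y - x‖ ^ 2 := by
  -- On the segment, subtract from `h` the linear and quadratic terms of the bound. Cauchy–Schwarz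
  -- and the Lipschitz condition make the derivative nonpositive, so the claim is `φ 1 ≤ φ 0`.
  set φ : ℝ → ℝ := fun t => h (x + t • (y - x)) - t * inner ℝ (gradient h x) (y - x)
    - L / 2 * t ^ 2 * ‖y - x‖ ^ 2 with hφ
  have hd : ∀ t, HasDerivAt φ (inner ℝ (gradient h (x + t • (y - x))) (y - x)
      - inner ℝ (gradient h x) (y - x) - L * t * ‖y - x‖ ^ 2) t := by
    intro t
    have h1 : HasDerivAt (fun t : ℝ => x + t • (y - x)) (y - x) t := by
      simpa using ((hasDerivAt_id t).smul_const (y - x)).const_add x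
    have h2 := (hh (x + t • (y - x))).hasGradientAt.hasFDerivAt.comp_hasDerivAt t h1
    have h3 := (hasDerivAt_id t).mul_const (inner ℝ (gradient h x) (y - x))
    have h4 := (((hasDerivAt_id t).pow 2).const_mul (L / 2)).mul_const (‖y - x‖ ^ 2)
    refine ((h2.sub h3).sub h4).congr_deriv ?_
    simp only [InnerProductSpace.toDual_apply_apply, id]
    ring
  have hanti : AntitoneOn φ (Set.Icc 0 1) := by
    refine antitoneOn_of_deriv_nonpos (convex_Icc 0 1)
      (fun t _ => (hd t).continuousAt.continuousWithinAt)
      (fun t _ => (hd t).differentiableAt.differentiableWithinAt) fun t ht => ?_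
    rw [interior_Icc] at ht
    rw [(hd t).deriv, ← inner_sub_left]
    have h1 := real_inner_le_norm (gradient h (x + t • (y - x)) - gradient h x) (y - x)
    have h2 := hL (x + t • (y - x)) x
    rw [add_sub_cancel_left, norm_smul, Real.norm_of_nonneg ht.1.le] at h2
    nlinarith [norm_nonneg (y - x)]
  have := hanti (Set.left_mem_Icc.2 zero_le_one) (Set.right_mem_Icc.2 zero_le_one) zero_le_one
  simp only [hφ, one_smul, add_sub_cancel, zero_smul, add_zero, one_mul, zero_mul, one_pow,
    mul_one, ne_eq, OfNat.ofNat_ne_zero, not_false_eq_true, zero_pow, mul_zero, sub_zero] at this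
  linarith

/-- Decrease of the objective in an inexact composite step. -/
lemma avg_le_of_model_le [NeZero n] {f : Fin n → Vec d → ℝ} (hf : ∀ i, Differentiable ℝ (f i))
    {Δ₁ lam : ℝ} (hED : DelegateSimilar f Δ₁) (hlam : Δ₁ < lam) {x g y : Vec d}
    (h : model f lam x g y ≤ model f lam x g x) :
    avg f y + (lam - Δ₁) / 4 * ‖y - x‖ ^ 2
      ≤ avg f x + 1 / (lam - Δ₁) * ‖g - gradient (avg f) x‖ ^ 2 := by
  have h1 := le_add_inner_gradient (fun z => (hasGradientAt_diffFn hf 0 z).differentiableAt) hED x y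
  rw [gradient_diffFn hf] at h1
  simp only [model, sub_self, inner_zero_right, norm_zero] at h
  have h2 : avg f y = f 0 y + diffFn f 0 y := by simp [diffFn]
  have h3 : avg f x = f 0 x + diffFn f 0 x := by simp [diffFn]
  have h4 : inner ℝ (gradient (avg f) x - gradient (f 0) x) (y - x)
      - inner ℝ (g - gradient (f 0) x) (y - x)
      = - inner ℝ (g - gradient (avg f) x) (y - x) := by
    simp only [← inner_sub_left, ← inner_neg_left]
    congr 1
    abel
  have h5 := neg_le_of_abs_le (abs_real_inner_le_norm (g - gradient (avg f) x) (y - x))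
  set e := ‖g - gradient (avg f) x‖
  set r := ‖y - x‖
  have ha : 0 < lam - Δ₁ := sub_pos.2 hlam
  -- Young's inequality, weighted to spend half of the quadratic term `(lam - Δ₁) / 2 * r ^ 2` that
  -- the descent lemma leaves.
  have h6 : e * r ≤ 1 / (lam - Δ₁) * e ^ 2 + (lam - Δ₁) / 4 * r ^ 2 := by
    have : 1 / (lam - Δ₁) * e ^ 2 + (lam - Δ₁) / 4 * r ^ 2 - e * r
        = (2 * e - (lam - Δ₁) * r) ^ 2 / (4 * (lam - Δ₁)) := by
      field_simp
      ring
    have h7 : 0 ≤ (2 * e - (lam - Δ₁) * r) ^ 2 / (4 * (lam - Δ₁)) := by positivity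
    linarith
  linarith

/-- The model gradient misses `∇f(y)` by the estimation error, the change of `∇h_1` and the proximal
term; the last two together are at most `(lam + Δ₁) ‖y - x‖`. -/
lemma norm_gradient_avg_sq_le [NeZero n] {f : Fin n → Vec d → ℝ}
    (hf : ∀ i, Differentiable ℝ (f i)) {Δ₁ lam : ℝ} (hED : DelegateSimilar f Δ₁)
    (hlam : 0 ≤ lam) (x g y : Vec d) :
    ‖gradient (avg f) y‖ ^ 2 ≤ 3 * (‖gradient (model f lam x g) y‖ ^ 2
      + ‖g - gradient (avg f) x‖ ^ 2 + (lam + Δ₁) ^ 2 * ‖y - x‖ ^ 2) := by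
  have h0 := hED y x
  have h1 : gradient (avg f) y = gradient (model f lam x g) y - (g - gradient (avg f) x)
      + ((gradient (diffFn f 0) y - gradient (diffFn f 0) x) - lam • (y - x)) := by
    rw [gradient_model hf, gradient_diffFn hf, gradient_diffFn hf]
    abel
  have h2 : ‖gradient (avg f) y‖ ≤ ‖gradient (model f lam x g) y‖ + ‖g - gradient (avg f) x‖
      + (lam + Δ₁) * ‖y - x‖ := by
    rw [h1]
    refine (norm_add_le _ _).trans (add_le_add (norm_sub_le _ _) ?_)
    refine (norm_sub_le _ _).trans ?_
    rw [norm_smul, Real.norm_of_nonneg hlam]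
    linarith
  set G := ‖gradient (model f lam x g) y‖
  set e := ‖g - gradient (avg f) x‖
  set r := ‖y - x‖
  calc _ ≤ (G + e + (lam + Δ₁) * r) ^ 2 := by gcongr
    _ ≤ _ := by nlinarith [sq_nonneg (G - e), sq_nonneg (G - (lam + Δ₁) * r),
        sq_nonneg (e - (lam + Δ₁) * r)]

/-! ### Sampling clients without replacement -/

lemma card_powersetCard_superset (s : Finset (Fin n)) {m : ℕ} (hs : s.card ≤ m) :
    ((Finset.powersetCard m (Finset.univ : Finset (Fin n))).filter (s ⊆ ·)).card
      = (n - s.card).choose (m - s.card) := by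
  rw [Finset.card_filter_powersetCard_subset _ _ _ (Finset.subset_univ s) hs, Finset.card_univ,
    Fintype.card_fin]

lemma card_filter_mem_powersetCard {m : ℕ} (hm : 1 ≤ m) (hmn : m ≤ n) (i : Fin n) :
    (((Finset.powersetCard m Finset.univ).filter (i ∈ ·)).card : ℝ) * n = m * n.choose m := by
  have h := card_powersetCard_superset {i} (m := m) (by simpa using hm)
  simp only [Finset.singleton_subset_iff, Finset.card_singleton] at h
  rw [h]
  obtain ⟨m, rfl⟩ := Nat.exists_eq_add_of_le' hm
  obtain ⟨n, rfl⟩ := Nat.exists_eq_add_of_le' (hm.trans hmn)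
  have := Nat.add_one_mul_choose_eq n m
  simp only [Nat.add_sub_cancel]
  exact_mod_cast (by linarith : n.choose m * (n + 1) = (m + 1) * (n + 1).choose (m + 1))

lemma card_filter_pair_mem_powersetCard {m : ℕ} (hm : 1 ≤ m) (hmn : m ≤ n) {i j : Fin n}
    (hij : i ≠ j) :
    (((Finset.powersetCard m Finset.univ).filter (fun A => i ∈ A ∧ j ∈ A)).card : ℝ)
      * (n * (n - 1)) = m * (m - 1) * n.choose m := by
  -- For `m = 1` no sample contains a pair, and the truncated `m - 2` in the count would be wrong.
  rcases hm.eq_or_lt with rfl | hm2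
  · have : (Finset.powersetCard 1 Finset.univ).filter (fun A => i ∈ A ∧ j ∈ A) = ∅ := by
      refine Finset.filter_eq_empty_iff.2 fun A hA h => hij ?_
      exact Finset.card_le_one.1 (Finset.mem_powersetCard.1 hA).2.le i h.1 j h.2
    simp [this]
  · have h := card_powersetCard_superset {i, j} (m := m) (by rw [Finset.card_pair hij]; exact hm2)
    simp only [Finset.insert_subset_iff, Finset.singleton_subset_iff, Finset.card_pair hij] at h
    rw [h]
    obtain ⟨m, rfl⟩ := Nat.exists_eq_add_of_le' hm2
    obtain ⟨n, rfl⟩ := Nat.exists_eq_add_of_le' (le_trans hm2 hmn)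
    have h1 : ((n : ℝ) + 1) * n.choose m = (n + 1).choose (m + 1) * (m + 1) := by
      exact_mod_cast Nat.add_one_mul_choose_eq n m
    have h2 : ((n : ℝ) + 2) * (n + 1).choose (m + 1) = (n + 2).choose (m + 2) * (m + 2) := by
      exact_mod_cast Nat.add_one_mul_choose_eq (n + 1) (m + 1)
    simp only [Nat.succ_eq_add_one, Nat.reduceAdd, Nat.add_sub_cancel]
    push_cast
    linear_combination ((n : ℝ) + 2) * h1 + ((m : ℝ) + 1) * h2

/-- The second moment of the sum of a random `m`-subset of a centred family. -/
lemma sum_powersetCard_norm_sq {E : Type*} [NormedAddCommGroup E] [InnerProductSpace ℝ E]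
    {m : ℕ} (hm : 1 ≤ m) (hmn : m ≤ n) (u : Fin n → E) (hu : ∑ i, u i = 0) :
    (∑ A ∈ Finset.powersetCard m Finset.univ, ‖∑ i ∈ A, u i‖ ^ 2) / n.choose m
      = m * (((n : ℝ) - m) / (n - 1)) * ((1 / (n : ℝ)) * ∑ i, ‖u i‖ ^ 2) := by
  have hn : 1 ≤ n := hm.trans hmn
  -- For `n = 1` the factor `0 / 0` is `0`; the left side vanishes too, as the only sample is the
  -- whole centred family.
  rcases hn.eq_or_lt with rfl | hn2
  · obtain rfl : m = 1 := le_antisymm hmn hm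
    have : ∀ A ∈ Finset.powersetCard 1 (Finset.univ : Finset (Fin 1)), ‖∑ i ∈ A, u i‖ ^ 2 = 0 := by
      intro A hA
      have : A = Finset.univ := Finset.eq_univ_of_card _ (Finset.mem_powersetCard.1 hA).2
      rw [this, hu, norm_zero, zero_pow two_ne_zero]
    rw [Finset.sum_eq_zero this]
    simp
  have hC : (0 : ℝ) < n.choose m := by exact_mod_cast Nat.choose_pos hmn
  have hn0 : (0 : ℝ) < n := by exact_mod_cast hn
  have hn1 : (0 : ℝ) < (n : ℝ) - 1 := sub_pos.2 (by exact_mod_cast hn2)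
  set c₁ : ℝ := m * n.choose m / n with hc₁
  set c₂ : ℝ := m * (m - 1) * n.choose m / (n * (n - 1)) with hc₂
  set P := Finset.powersetCard m (Finset.univ : Finset (Fin n))
  -- The count of samples containing `i` and `j` is a constant plus a diagonal correction. The
  -- constant part multiplies `‖∑ u i‖² = 0`, so only the diagonal survives.
  have hcount : ∀ i j, ((P.filter (fun A => i ∈ A ∧ j ∈ A)).card : ℝ)
      = c₂ + if i = j then c₁ - c₂ else 0 := by
    intro i j
    split_ifs with hij
    · subst hij
      have := card_filter_mem_powersetCard hm hmn i
      simp only [and_self, hc₁]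
      rw [add_sub_cancel, eq_div_iff hn0.ne', this]
    · have := card_filter_pair_mem_powersetCard hm hmn hij
      rw [add_zero, hc₂, eq_div_iff (by positivity), this]
  have hexp : ∑ A ∈ P, ‖∑ i ∈ A, u i‖ ^ 2
      = ∑ i, ∑ j, ((P.filter (fun A => i ∈ A ∧ j ∈ A)).card : ℝ) * inner ℝ (u i) (u j) := by
    have : ∀ A ∈ P, ‖∑ i ∈ A, u i‖ ^ 2
        = ∑ i, ∑ j, if i ∈ A ∧ j ∈ A then inner ℝ (u i) (u j) else 0 := by
      intro A _
      rw [← real_inner_self_eq_norm_sq, sum_inner]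
      simp_rw [inner_sum, ite_and]
      simp
    rw [Finset.sum_congr rfl this, Finset.sum_comm]
    refine Finset.sum_congr rfl fun i _ => ?_
    rw [Finset.sum_comm]
    refine Finset.sum_congr rfl fun j _ => ?_
    rw [← Finset.sum_filter, Finset.sum_const, nsmul_eq_mul]
  have hzero : ∑ i, ∑ j, (inner ℝ (u i) (u j) : ℝ) = 0 := by
    simp_rw [← inner_sum, hu, inner_zero_right, Finset.sum_const_zero]
  have hfin : ∑ A ∈ P, ‖∑ i ∈ A, u i‖ ^ 2 = (c₁ - c₂) * ∑ i, ‖u i‖ ^ 2 := by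
    rw [hexp]
    simp_rw [hcount, add_mul, Finset.sum_add_distrib, ← Finset.mul_sum, hzero, ite_mul, zero_mul,
      Finset.sum_ite_eq, Finset.mem_univ, if_true, real_inner_self_eq_norm_sq, mul_zero, zero_add,
      ← Finset.mul_sum]
  rw [hfin, hc₁, hc₂]
  field_simp
  ring

/-- The variance bound of sampling without replacement, for gradient differences. -/
lemma sum_powersetCard_error_le {f : Fin n → Vec d → ℝ} (hf : ∀ i, Differentiable ℝ (f i))
    {m : ℕ} (hm : 1 ≤ m) (hmn : m ≤ n) {δ : ℝ} (hSOD : AverageSimilar f δ) (x w : Vec d) :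
    (∑ A ∈ Finset.powersetCard m Finset.univ,
      ‖(1 / (m : ℝ)) • ∑ i ∈ A, (gradient (diffFn f i) x - gradient (diffFn f i) w)‖ ^ 2)
        / n.choose m ≤ deltaM n m δ ^ 2 * ‖x - w‖ ^ 2 := by
  have hn0 : (0 : ℝ) < n := by exact_mod_cast hm.trans hmn
  have hm0 : (0 : ℝ) < m := by exact_mod_cast hm
  have hm1 : (1 : ℝ) ≤ m := by exact_mod_cast hm
  have hmn' : (m : ℝ) ≤ n := by exact_mod_cast hmn
  set u : Fin n → Vec d := fun i => gradient (diffFn f i) x - gradient (diffFn f i) w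
  have hu : ∑ i, u i = 0 := by
    have : ∀ z, ∑ i, gradient (diffFn f i) z = 0 := by
      intro z
      simp_rw [gradient_diffFn hf, gradient_avg hf, Finset.sum_sub_distrib, Finset.sum_const,
        Finset.card_univ, Fintype.card_fin, ← Nat.cast_smul_eq_nsmul ℝ, smul_smul]
      rw [mul_one_div_cancel hn0.ne', one_smul, sub_self]
    simp only [u, Finset.sum_sub_distrib, this, sub_self]
  have h := sum_powersetCard_norm_sq hm hmn u hu
  simp_rw [norm_smul, mul_pow, ← Finset.mul_sum, mul_div_assoc]
  rw [h]
  have hq : (0 : ℝ) ≤ ((n : ℝ) - m) / (n - 1) :=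
    div_nonneg (sub_nonneg.2 hmn') (by linarith)
  have hδ : deltaM n m δ ^ 2 = ((n : ℝ) - m) / (n - 1) / m * δ ^ 2 := by
    rw [deltaM, mul_pow, Real.sq_sqrt (by positivity)]
  rw [hδ, Real.norm_of_nonneg (by positivity)]
  calc _ = ((n : ℝ) - m) / (n - 1) / m * ((1 / (n : ℝ)) * ∑ i, ‖u i‖ ^ 2) := by
        -- The quotient is kept opaque, because `n - 1` may be zero.
        generalize ((n : ℝ) - m) / (n - 1) = q
        field_simp
    _ ≤ ((n : ℝ) - m) / (n - 1) / m * (δ ^ 2 * ‖x - w‖ ^ 2) := by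
        exact mul_le_mul_of_nonneg_left (hSOD x w) (by positivity)
    _ = _ := by ring

lemma deltaM_nonneg {δ : ℝ} (hδ : 0 ≤ δ) (m : ℕ) : 0 ≤ deltaM n m δ :=
  mul_nonneg (Real.sqrt_nonneg _) hδ

/-- The error of the SVRG estimator in terms of the difference functions. -/
lemma svrg_error_eq {f : Fin n → Vec d → ℝ} (hf : ∀ i, Differentiable ℝ (f i))
    {m : ℕ} (hm : 1 ≤ m) {A : Finset (Fin n)} (hA : A.card = m) (x w : Vec d) :
    gradient (batchAvg f m A) x + gradient (avg f) w - gradient (batchAvg f m A) w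
        - gradient (avg f) x
      = - ((1 / (m : ℝ)) • ∑ i ∈ A, (gradient (diffFn f i) x - gradient (diffFn f i) w)) := by
  have hm0 : (m : ℝ) ≠ 0 := by exact_mod_cast (by omega : m ≠ 0)
  simp_rw [gradient_batchAvg hf, gradient_diffFn hf, Finset.sum_sub_distrib, Finset.sum_const, hA,
    ← Nat.cast_smul_eq_nsmul ℝ, smul_sub, smul_smul, one_div_mul_cancel hm0, one_smul]
  abel

/-! ### Solving the coupled recursions -/

/-- The real inequalities from which the convergence rate follows: `R`, `D`, `V`, `G`, `N` are the
sequences of expected squared step lengths, distances to the reference point, estimation errors,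
model gradients and gradients. -/
lemma sum_le_of_recursions {Δ σ p F : ℝ} (hΔ : 0 < Δ) (hσ : 0 ≤ σ) (hp : 0 < p) (hp1 : p ≤ 1) (hF : 0 ≤ F)
    {lam : ℝ} (hlam : lam = 3 * Δ + 16 * σ / p) (T : ℕ) {R D V G N : ℕ → ℝ}
    (hR : ∀ t, 0 ≤ R t) (hDn : ∀ t, 0 ≤ D t)
    (hstep : (lam - Δ) / 4 * ∑ t ∈ Finset.range T, R t
      ≤ F + 1 / (lam - Δ) * ∑ t ∈ Finset.range T, V t)
    (hV : ∀ t < T, V t ≤ σ ^ 2 * D t) (hD0 : D 0 = 0)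
    (hD : ∀ t, t + 1 < T → D (t + 1) ≤ (1 - p / 2) * D t + 2 / p * R t)
    (hG : ∑ t ∈ Finset.range T, G t
      ≤ (lam + Δ) ^ 2 / (lam - Δ) * F + ∑ t ∈ Finset.range T, V t)
    (hN : ∀ t < T, N t ≤ 3 * (G t + V t + (lam + Δ) ^ 2 * R t)) :
    ∑ t ∈ Finset.range T, N t ≤ 256 * (Δ + 6 * σ / p) * F := by
  -- The weights are chosen so that the induction step adds `p / 2 * D (k + 1) + (1 - p / 2) * D (k
  -- + 1) = D (k + 1)`, which is what the recursion bounds.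
  have hDR : ∀ k, k < T → p / 2 * ∑ t ∈ Finset.range (k + 1), D t + (1 - p / 2) * D k
      ≤ 2 / p * ∑ t ∈ Finset.range k, R t := by
    intro k
    induction k with
    | zero => simp [hD0]
    | succ k ih =>
      intro hk
      have h1 := ih (by omega)
      have h2 := hD k hk
      rw [Finset.sum_range_succ, Finset.sum_range_succ R k]
      linarith
  set SR := ∑ t ∈ Finset.range T, R t
  set SD := ∑ t ∈ Finset.range T, D t with hSD
  set SV := ∑ t ∈ Finset.range T, V t
  set SG := ∑ t ∈ Finset.range T, G t
  have hSR : 0 ≤ SR := Finset.sum_nonneg fun t _ => hR t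
  have h1 : p / 2 * SD ≤ 2 / p * SR := by
    rcases T with _ | T
    · simp [SR, SD]
    · have h2 := hDR T (Nat.lt_succ_self T)
      have h3 : 2 / p * ∑ t ∈ Finset.range T, R t ≤ 2 / p * SR := by
        refine mul_le_mul_of_nonneg_left ?_ (by positivity)
        exact Finset.sum_le_sum_of_subset_of_nonneg (Finset.range_mono T.le_succ) fun t _ _ => hR t
      have h4 : 0 ≤ (1 - p / 2) * D T := mul_nonneg (by linarith) (hDn T)
      linarith
  set s := 2 * σ / p with hs
  have hs0 : 0 ≤ s := by positivity
  have h2 : SV ≤ s ^ 2 * SR := by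
    have h3 : SV ≤ σ ^ 2 * SD := by
      rw [hSD, Finset.mul_sum]
      exact Finset.sum_le_sum fun t ht => hV t (Finset.mem_range.1 ht)
    have h4 : SD ≤ 4 / p ^ 2 * SR := by
      have : SD = 2 / p * (p / 2 * SD) := by field_simp
      rw [this]
      calc _ ≤ 2 / p * (2 / p * SR) := by gcongr
        _ = _ := by ring
    calc SV ≤ σ ^ 2 * (4 / p ^ 2 * SR) := h3.trans (by gcongr)
      _ = _ := by rw [hs]; ring
  set a := lam - Δ with ha
  have ha' : a = 2 * Δ + 8 * s := by rw [ha, hlam, hs]; ring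
  have hA : lam + Δ = a + 2 * Δ := by rw [ha]; ring
  have ha0 : 0 < a := by rw [ha']; positivity
  -- This is where the size of `lam` matters: `a ≥ 8 s`, so the error uses only `a / 64` of the `a /
  -- 4` available in the descent.
  have hsa : s ^ 2 ≤ a ^ 2 / 64 := by nlinarith
  have h5 : a * SR ≤ 64 / 15 * F := by
    have : 1 / a * SV ≤ a / 64 * SR := by
      calc 1 / a * SV ≤ 1 / a * (a ^ 2 / 64 * SR) := by gcongr; exact h2.trans (by gcongr)
        _ = _ := by field_simp
    linarith
  have h6 : SV ≤ a / 15 * F := by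
    calc SV ≤ a ^ 2 / 64 * SR := h2.trans (by gcongr)
      _ = a / 64 * (a * SR) := by ring
      _ ≤ a / 64 * (64 / 15 * F) := by gcongr
      _ = _ := by ring
  have hA2 : lam + Δ ≤ 2 * a := by rw [hA, ha']; linarith
  have hA0 : 0 ≤ lam + Δ := by rw [hA]; positivity
  have h7 : (lam + Δ) ^ 2 / a ≤ 2 * (lam + Δ) := by
    rw [div_le_iff₀ ha0]
    nlinarith
  have h8 : (lam + Δ) ^ 2 * SR ≤ 2 * (lam + Δ) * (64 / 15 * F) := by
    calc _ = (lam + Δ) ^ 2 / a * (a * SR) := by field_simp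
      _ ≤ _ := by gcongr
  have h9 : (lam + Δ) ^ 2 / a * F ≤ 2 * (lam + Δ) * F := by gcongr
  have h10 : ∑ t ∈ Finset.range T, N t ≤ 3 * (SG + SV + (lam + Δ) ^ 2 * SR) := by
    rw [Finset.mul_sum, ← Finset.sum_add_distrib, ← Finset.sum_add_distrib, Finset.mul_sum]
    exact Finset.sum_le_sum fun t ht => hN t (Finset.mem_range.1 ht)
  have h11 : 256 * (Δ + 6 * σ / p) * F = (256 * Δ + 768 * s) * F := by rw [hs]; ring
  have h12 : lam + Δ = 4 * Δ + 8 * s := by rw [hA, ha']; ring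
  rw [h12] at h8 h9 hG h10
  have hsF : 0 ≤ s * F := by positivity
  have hΔF : 0 ≤ Δ * F := by positivity
  rw [ha'] at h6
  rw [h11]
  rw [h12] at *
  linarith

end Deterministic
-- Independence and expected errors along a run
section Stochastic

variable {n d : ℕ} {Ω : Type*}

lemma enorm_sq_eq_ofReal {E : Type*} [NormedAddCommGroup E] (v : E) :
    ‖v‖ₑ ^ 2 = ENNReal.ofReal (‖v‖ ^ 2) := by
  rw [← ofReal_norm, ENNReal.ofReal_pow (norm_nonneg v)]

lemma measurable_gradient {E : Type*} [NormedAddCommGroup E] [InnerProductSpace ℝ E]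
    [CompleteSpace E] [MeasurableSpace E] [BorelSpace E] (h : E → ℝ) :
    Measurable (gradient h) :=
  (InnerProductSpace.toDual ℝ E).symm.continuous.measurable.comp (measurable_fderiv ℝ h)

lemma gap_nonneg {f : Fin n → Vec d → ℝ} (hbdd : BddBelow (Set.range (avg f))) (x : Vec d) :
    0 ≤ gap f x :=
  sub_nonneg.2 (ciInf_le hbdd x)

section Run

variable [mΩ : MeasurableSpace Ω] {μ : Measure Ω} {m : ℕ} {p : ℝ} {x₀ : Vec d}
  {𝓕 : Filtration ℕ mΩ} {x : ℕ → Ω → Vec d} {S : ℕ → Ω → Finset (Fin n)} {b : ℕ → Ω → Bool}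

lemma IsRun.measurable_iterate (h : IsRun μ m p x₀ 𝓕 x S b) (t : ℕ) : Measurable (x t) :=
  (h.adapted t).mono (𝓕.le t) le_rfl

lemma IsRun.measurableSet_set_eq (h : IsRun μ m p x₀ 𝓕 x S b) {t : ℕ} (ht : 1 ≤ t)
    (A : Finset (Fin n)) : MeasurableSet {ω | S t ω = A} :=
  𝓕.le (t + 1) _ (h.set_known t ht _ ⟨{A}, trivial, rfl⟩)

lemma IsRun.measurableSet_coin_eq_filtration (h : IsRun μ m p x₀ 𝓕 x S b) {t : ℕ} (ht : 1 ≤ t)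
    (v : Bool) : MeasurableSet[𝓕 (t + 1)] {ω | b t ω = v} :=
  h.coin_known t ht _ ⟨{v}, trivial, rfl⟩

lemma IsRun.measurableSet_coin_eq (h : IsRun μ m p x₀ 𝓕 x S b) {t : ℕ} (ht : 1 ≤ t)
    (v : Bool) : MeasurableSet {ω | b t ω = v} :=
  𝓕.le (t + 1) _ (h.measurableSet_coin_eq_filtration ht v)

/-- The index is `t + 1` because the coin `b t` is revealed only then. Hence the previous reference
point is already known when the next set and coin are drawn. -/
lemma IsRun.measurable_refPoint_filtration (h : IsRun μ m p x₀ 𝓕 x S b) (t : ℕ) :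
    Measurable[𝓕 (t + 1)] (refPoint x b t) := by
  induction t with
  | zero => exact (h.adapted 0).mono (𝓕.mono (Nat.zero_le _)) le_rfl
  | succ t ih =>
    exact Measurable.ite (f := x (t + 1)) (g := refPoint x b t) (mβ := inferInstance)
      (h.measurableSet_coin_eq_filtration (Nat.le_add_left 1 t) true)
      ((h.adapted (t + 1)).mono (𝓕.mono (Nat.le_succ _)) le_rfl)
      (ih.mono (𝓕.mono (Nat.le_succ _)) le_rfl)

lemma IsRun.measurable_refPoint (h : IsRun μ m p x₀ 𝓕 x S b) (t : ℕ) :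
    Measurable (refPoint x b t) :=
  (h.measurable_refPoint_filtration t).mono (𝓕.le _) le_rfl

lemma IsRun.measurable_step_sq (h : IsRun μ m p x₀ 𝓕 x S b) (t : ℕ) :
    Measurable fun ω => ‖x (t + 1) ω - x t ω‖ₑ ^ 2 :=
  ((h.measurable_iterate (t + 1)).sub (h.measurable_iterate t)).enorm.pow_const 2

lemma IsRun.measure_coin_false [IsProbabilityMeasure μ] (h : IsRun μ m p x₀ 𝓕 x S b)
    (hp : 0 ≤ p) {t : ℕ} (ht : 1 ≤ t) : μ {ω | b t ω = false} = ENNReal.ofReal (1 - p) := by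
  have h1 : {ω | b t ω = false} = {ω | b t ω = true}ᶜ := by
    ext ω
    simp
  rw [h1, prob_compl_eq_one_sub (h.measurableSet_coin_eq ht true), h.coin_bernoulli t ht,
    ENNReal.ofReal_sub _ hp, ENNReal.ofReal_one]

/-- The `m`-element sets have equal masses adding up to one, so no mass is left for sets of other
sizes. -/
lemma IsRun.ae_card_eq [IsProbabilityMeasure μ] (h : IsRun μ m p x₀ 𝓕 x S b) (hmn : m ≤ n)
    {t : ℕ} (ht : 1 ≤ t) : ∀ᵐ ω ∂μ, (S t ω).card = m := by
  have h1 : {ω | (S t ω).card = m}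
      = ⋃ A ∈ Finset.powersetCard m (Finset.univ : Finset (Fin n)), {ω | S t ω = A} := by
    ext ω
    simp
  have h2 : μ {ω | (S t ω).card = m} = 1 := by
    rw [h1, measure_biUnion_finset _ fun A _ => h.measurableSet_set_eq ht A]
    · rw [Finset.sum_congr rfl fun A hA =>
        h.set_uniform t ht A (Finset.mem_powersetCard.1 hA).2, Finset.sum_const,
        Finset.card_powersetCard, Finset.card_univ, Fintype.card_fin, nsmul_eq_mul]
      exact ENNReal.mul_inv_cancel (by exact_mod_cast (Nat.choose_pos hmn).ne')
        (ENNReal.natCast_ne_top _)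
    · intro A _ B _ hAB
      refine Set.disjoint_left.2 fun ω hA hB => hAB ?_
      exact hA.symm.trans hB
  rw [← prob_compl_eq_zero_iff] at h2
  · exact h2
  · rw [h1]
    exact Finset.measurableSet_biUnion _ fun A _ => h.measurableSet_set_eq ht A

/-- The form in which `fresh` is used: known quantities factor from events of the current set and
coin. -/
lemma IsRun.lintegral_mul_indicator (h : IsRun μ m p x₀ 𝓕 x S b) {t : ℕ} (ht : 1 ≤ t)
    {φ : Ω → ℝ≥0∞} (hφ : Measurable[𝓕 t] φ) {B : Set Ω}
    (hB : MeasurableSet[MeasurableSpace.comap (S t) ⊤ ⊔ MeasurableSpace.comap (b t) ⊤] B) :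
    ∫⁻ ω, φ ω * B.indicator 1 ω ∂μ = (∫⁻ ω, φ ω ∂μ) * μ B := by
  have hle : MeasurableSpace.comap (S t) ⊤ ⊔ MeasurableSpace.comap (b t) ⊤ ≤ mΩ :=
    sup_le ((h.set_known t ht).trans (𝓕.le _)) ((h.coin_known t ht).trans (𝓕.le _))
  have hind : Measurable[MeasurableSpace.comap (S t) ⊤ ⊔ MeasurableSpace.comap (b t) ⊤]
      (B.indicator 1 : Ω → ℝ≥0∞) := measurable_const.indicator hB
  rw [lintegral_mul_eq_lintegral_mul_lintegral_of_independent_measurableSpace (𝓕.le t) hle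
    (h.fresh t ht).symm hφ hind, lintegral_indicator_one (hle _ hB)]

/-- If the coin shows `true` the distance is zero; otherwise the reference point is the old one,
which is independent of the coin. -/
lemma IsRun.lintegral_refPoint_dist (h : IsRun μ m p x₀ 𝓕 x S b) [IsProbabilityMeasure μ]
    (hp : 0 ≤ p) (t : ℕ) :
    ∫⁻ ω, ‖x (t + 1) ω - refPoint x b (t + 1) ω‖ₑ ^ 2 ∂μ
      = ENNReal.ofReal (1 - p) * ∫⁻ ω, ‖x (t + 1) ω - refPoint x b t ω‖ₑ ^ 2 ∂μ := by
  have ht : 1 ≤ t + 1 := Nat.le_add_left 1 t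
  rw [mul_comm, ← h.measure_coin_false hp ht, ← h.lintegral_mul_indicator ht]
  · refine lintegral_congr fun ω => ?_
    cases hb : b (t + 1) ω <;> simp [refPoint, hb]
  · exact ((measurable_fst.sub measurable_snd).enorm.pow_const 2).comp
      ((h.adapted (t + 1)).prodMk (h.measurable_refPoint_filtration t))
  · exact (le_sup_right (a := MeasurableSpace.comap (S (t + 1)) ⊤)) _ ⟨{false}, trivial, rfl⟩

/-- The squared error of the minibatch `A` at the point `z.1` with reference point `z.2`. -/
noncomputable def batchError (f : Fin n → Vec d → ℝ) (m : ℕ) (A : Finset (Fin n)) (z : Vec d × Vec d) : ℝ :=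
  ‖(1 / (m : ℝ)) • ∑ i ∈ A, (gradient (diffFn f i) z.1 - gradient (diffFn f i) z.2)‖ ^ 2

lemma measurable_batchError (f : Fin n → Vec d → ℝ) (m : ℕ) (A : Finset (Fin n)) :
    Measurable (batchError f m A) := by
  have h : Measurable fun z : Vec d × Vec d =>
      ∑ i ∈ A, (gradient (diffFn f i) z.1 - gradient (diffFn f i) z.2) :=
    Finset.measurable_fun_sum _ fun i _ => ((measurable_gradient _).comp measurable_fst).sub
      ((measurable_gradient _).comp measurable_snd)
  exact (h.const_smul (1 / (m : ℝ))).norm.pow_const 2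

/-- Splitting by the value of the set turns the error into known quantities times fresh events,
ready for `IsRun.lintegral_mul_indicator`. If the coin shows `true`, the two minibatch gradients
cancel. -/
lemma IsRun.svrg_error_ae_eq (h : IsRun μ m p x₀ 𝓕 x S b) [IsProbabilityMeasure μ]
    {f : Fin n → Vec d → ℝ} (hf : ∀ i, Differentiable ℝ (f i)) (hm : 1 ≤ m) (hmn : m ≤ n)
    (t : ℕ) :
    (fun ω => ‖svrg f m x S b (t + 1) ω - gradient (avg f) (x (t + 1) ω)‖ₑ ^ 2)
      =ᵐ[μ] fun ω => ∑ A ∈ Finset.powersetCard m Finset.univ,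
        ENNReal.ofReal (batchError f m A (x (t + 1) ω, refPoint x b t ω))
          * ({ω | S (t + 1) ω = A} ∩ {ω | b (t + 1) ω = false}).indicator 1 ω := by
  filter_upwards [h.ae_card_eq hmn (Nat.le_add_left 1 t)] with ω hω
  simp only [svrg]
  rw [svrg_error_eq hf hm hω, enorm_neg, enorm_sq_eq_ofReal,
    Finset.sum_eq_single_of_mem (S (t + 1) ω) (by simp [hω])]
  · cases hb : b (t + 1) ω <;> simp [refPoint, hb, batchError]
  · intro A _ hA
    rw [Set.indicator_of_notMem (fun h => hA h.1.symm), mul_zero]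

lemma IsRun.measurable_batchError_filtration (h : IsRun μ m p x₀ 𝓕 x S b)
    (f : Fin n → Vec d → ℝ) (A : Finset (Fin n)) (t : ℕ) :
    Measurable[𝓕 (t + 1)]
      fun ω => ENNReal.ofReal (batchError f m A (x (t + 1) ω, refPoint x b t ω)) :=
  (measurable_batchError f m A).ennreal_ofReal.comp
    ((h.adapted (t + 1)).prodMk (h.measurable_refPoint_filtration t))

lemma IsRun.aemeasurable_svrg_error (h : IsRun μ m p x₀ 𝓕 x S b) [IsProbabilityMeasure μ]
    {f : Fin n → Vec d → ℝ} (hf : ∀ i, Differentiable ℝ (f i)) (hm : 1 ≤ m) (hmn : m ≤ n)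
    (t : ℕ) :
    AEMeasurable (fun ω => ‖svrg f m x S b t ω - gradient (avg f) (x t ω)‖ₑ ^ 2) μ := by
  rcases t with _ | t
  · simp [svrg]
  refine AEMeasurable.congr (Measurable.aemeasurable ?_) (h.svrg_error_ae_eq hf hm hmn t).symm
  refine Finset.measurable_fun_sum _ fun A _ => Measurable.mul ?_ ?_
  · exact (h.measurable_batchError_filtration f A t).mono (𝓕.le _) le_rfl
  · exact measurable_one.indicator ((h.measurableSet_set_eq (Nat.le_add_left 1 t) A).inter
      (h.measurableSet_coin_eq (Nat.le_add_left 1 t) false))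

/-- Averaging over the uniform set leaves the sampling variance at the old reference point. The
factor `1 - p` from the coin appears in both the error and the new distance, so it cancels. -/
lemma IsRun.lintegral_svrg_error_le (h : IsRun μ m p x₀ 𝓕 x S b) [IsProbabilityMeasure μ]
    (hp : 0 ≤ p) {f : Fin n → Vec d → ℝ} (hf : ∀ i, Differentiable ℝ (f i)) (hm : 1 ≤ m)
    (hmn : m ≤ n) {δ : ℝ} (hSOD : AverageSimilar f δ) (t : ℕ) :
    ∫⁻ ω, ‖svrg f m x S b t ω - gradient (avg f) (x t ω)‖ₑ ^ 2 ∂μ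
      ≤ ENNReal.ofReal (deltaM n m δ ^ 2) * ∫⁻ ω, ‖x t ω - refPoint x b t ω‖ₑ ^ 2 ∂μ := by
  rcases t with _ | t
  · simp [svrg]
  have ht : 1 ≤ t + 1 := Nat.le_add_left 1 t
  have hS : ∀ A, MeasurableSet[MeasurableSpace.comap (S (t + 1)) ⊤] {ω | S (t + 1) ω = A} :=
    fun A => ⟨{A}, trivial, rfl⟩
  have hb : MeasurableSet[MeasurableSpace.comap (b (t + 1)) ⊤] {ω | b (t + 1) ω = false} :=
    ⟨{false}, trivial, rfl⟩
  have hmeas : ∀ A, Measurable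
      fun ω => ENNReal.ofReal (batchError f m A (x (t + 1) ω, refPoint x b t ω)) :=
    fun A => (h.measurable_batchError_filtration f A t).mono (𝓕.le _) le_rfl
  have hC : (0 : ℝ) < n.choose m := by exact_mod_cast Nat.choose_pos hmn
  have key : ∀ A ∈ Finset.powersetCard m (Finset.univ : Finset (Fin n)),
      ∫⁻ ω, ENNReal.ofReal (batchError f m A (x (t + 1) ω, refPoint x b t ω))
        * ({ω | S (t + 1) ω = A} ∩ {ω | b (t + 1) ω = false}).indicator 1 ω ∂μ
      = (∫⁻ ω, ENNReal.ofReal (batchError f m A (x (t + 1) ω, refPoint x b t ω)) ∂μ)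
        * (((n.choose m : ℕ) : ℝ≥0∞)⁻¹ * ENNReal.ofReal (1 - p)) := by
    intro A hA
    rw [h.lintegral_mul_indicator ht (h.measurable_batchError_filtration f A t)
      (MeasurableSet.inter ((le_sup_left : _ ≤ _ ⊔ MeasurableSpace.comap (b (t + 1)) ⊤) _ (hS A))
        ((le_sup_right : _ ≤ MeasurableSpace.comap (S (t + 1)) ⊤ ⊔ _) _ hb)),
      Indep_iff _ _ _ |>.1 (h.set_indep_coin (t + 1) ht) _ _ (hS A) hb,
      h.set_uniform _ ht A (Finset.mem_powersetCard.1 hA).2, h.measure_coin_false hp ht]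
  rw [h.lintegral_refPoint_dist hp, lintegral_congr_ae (h.svrg_error_ae_eq hf hm hmn t),
    lintegral_finsetSum, Finset.sum_congr rfl key, ← Finset.sum_mul, ← mul_assoc,
    ← lintegral_finsetSum _ fun A _ => hmeas A, mul_left_comm, mul_comm _ (ENNReal.ofReal (1 - p))]
  · refine mul_le_mul_right ?_ _
    rw [← lintegral_mul_const' _ _ (by simpa using (Nat.choose_pos hmn).ne'),
      ← lintegral_const_mul' _ _ ENNReal.ofReal_ne_top]
    refine lintegral_mono fun ω => ?_
    have h1 := sum_powersetCard_error_le hf hm hmn hSOD (x (t + 1) ω) (refPoint x b t ω)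
    rw [enorm_sq_eq_ofReal, ← ENNReal.ofReal_mul (sq_nonneg _),
      ← ENNReal.ofReal_sum_of_nonneg
        (f := fun A => batchError f m A (x (t + 1) ω, refPoint x b t ω)) fun A _ => sq_nonneg _, ← ENNReal.ofReal_natCast,
      ← ENNReal.ofReal_inv_of_pos hC, ← ENNReal.ofReal_mul
        (Finset.sum_nonneg fun A _ => by exact sq_nonneg _), ← div_eq_mul_inv]
    exact ENNReal.ofReal_le_ofReal h1
  · intro A _
    exact (hmeas A).mul (measurable_one.indicator
      ((h.measurableSet_set_eq ht A).inter (h.measurableSet_coin_eq ht false)))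

lemma norm_sub_sq_le_young {E : Type*} [NormedAddCommGroup E] {s : ℝ} (hs : 0 < s) (u v w : E) :
    ‖u - w‖ ^ 2 ≤ (1 + s) * ‖v - w‖ ^ 2 + (1 + 1 / s) * ‖u - v‖ ^ 2 := by
  have h := norm_sub_le_norm_sub_add_norm_sub u v w
  set a := ‖u - v‖
  set c := ‖v - w‖
  have h1 : (1 + s) * c ^ 2 + (1 + 1 / s) * a ^ 2 - (a + c) ^ 2 = (s * c - a) ^ 2 / s := by
    field_simp
    ring
  have h2 : 0 ≤ (s * c - a) ^ 2 / s := by positivity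
  calc _ ≤ (a + c) ^ 2 := by gcongr
    _ ≤ _ := by linarith

lemma IsRun.lintegral_refPoint_dist_succ_le (h : IsRun μ m p x₀ 𝓕 x S b) [IsProbabilityMeasure μ]
    (hp : 0 < p) (hp1 : p ≤ 1) (t : ℕ) :
    ∫⁻ ω, ‖x (t + 1) ω - refPoint x b (t + 1) ω‖ₑ ^ 2 ∂μ
      ≤ ENNReal.ofReal (1 - p / 2) * ∫⁻ ω, ‖x t ω - refPoint x b t ω‖ₑ ^ 2 ∂μ
        + ENNReal.ofReal (2 / p) * ∫⁻ ω, ‖x (t + 1) ω - x t ω‖ₑ ^ 2 ∂μ := by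
  rw [h.lintegral_refPoint_dist hp.le, ← lintegral_const_mul' _ _ ENNReal.ofReal_ne_top,
    ← lintegral_const_mul' _ _ ENNReal.ofReal_ne_top,
    ← lintegral_const_mul' _ _ ENNReal.ofReal_ne_top, ← lintegral_add_left]
  · refine lintegral_mono fun ω => ?_
    simp only [enorm_sq_eq_ofReal]
    have h1 : 0 ≤ 1 - p := sub_nonneg.2 hp1
    have h2 : 0 ≤ 1 - p / 2 := by linarith
    rw [← ENNReal.ofReal_mul h1, ← ENNReal.ofReal_mul h2, ← ENNReal.ofReal_mul (by positivity),
      ← ENNReal.ofReal_add (by positivity) (by positivity)]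
    refine ENNReal.ofReal_le_ofReal ?_
    -- With Young parameter `p / 2`, the growth `1 + p / 2` eats only half of the contraction `1 -
    -- p`.
    have h3 := norm_sub_sq_le_young (half_pos hp) (x (t + 1) ω) (x t ω) (refPoint x b t ω)
    have h4 : (1 - p) * (1 + p / 2) ≤ 1 - p / 2 := by nlinarith
    have h5 : (1 - p) * (1 + 1 / (p / 2)) ≤ 2 / p := by
      have : (1 - p) * (1 + 1 / (p / 2)) = 2 / p - 1 - p := by
        field_simp
        ring
      linarith
    calc _ ≤ (1 - p) * ((1 + p / 2) * ‖x t ω - refPoint x b t ω‖ ^ 2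
          + (1 + 1 / (p / 2)) * ‖x (t + 1) ω - x t ω‖ ^ 2) := by gcongr
      _ = (1 - p) * (1 + p / 2) * ‖x t ω - refPoint x b t ω‖ ^ 2
          + (1 - p) * (1 + 1 / (p / 2)) * ‖x (t + 1) ω - x t ω‖ ^ 2 := by ring
      _ ≤ _ := by gcongr
  · exact (((h.measurable_iterate t).sub (h.measurable_refPoint t)).enorm.pow_const 2).const_mul _

/-- The telescoping is done pathwise before integrating, so `f(x^t)` need not be integrable; only
nonnegative quantities are integrated. -/
lemma IsRun.lintegral_step_le [NeZero n] (h : IsRun μ m p x₀ 𝓕 x S b) [IsProbabilityMeasure μ]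
    {f : Fin n → Vec d → ℝ} (hf : ∀ i, Differentiable ℝ (f i)) (hm : 1 ≤ m) (hmn : m ≤ n)
    (hbdd : BddBelow (Set.range (avg f))) {Δ₁ lam : ℝ} (hED : DelegateSimilar f Δ₁)
    (hlam : Δ₁ < lam) {k : ℕ}
    (hdec : ∀ t < k, ∀ᵐ ω ∂μ, model f lam (x t ω) (svrg f m x S b t ω) (x (t + 1) ω)
      ≤ model f lam (x t ω) (svrg f m x S b t ω) (x t ω)) :
    ENNReal.ofReal ((lam - Δ₁) / 4)
        * ∑ t ∈ Finset.range k, ∫⁻ ω, ‖x (t + 1) ω - x t ω‖ₑ ^ 2 ∂μ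
      ≤ ENNReal.ofReal (gap f x₀) + ENNReal.ofReal (1 / (lam - Δ₁)) * ∑ t ∈ Finset.range k,
          ∫⁻ ω, ‖svrg f m x S b t ω - gradient (avg f) (x t ω)‖ₑ ^ 2 ∂μ := by
  have ha : 0 < lam - Δ₁ := sub_pos.2 hlam
  rw [← lintegral_finsetSum' _ fun t _ => h.aemeasurable_svrg_error hf hm hmn t,
    ← lintegral_finsetSum _ fun t _ => h.measurable_step_sq t,
    ← lintegral_const_mul' _ _ ENNReal.ofReal_ne_top,
    ← lintegral_const_mul' _ _ ENNReal.ofReal_ne_top]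
  have hconst : ENNReal.ofReal (gap f x₀) = ∫⁻ _, ENNReal.ofReal (gap f x₀) ∂μ := by simp
  rw [hconst, ← lintegral_add_left measurable_const]
  have hall : ∀ᵐ ω ∂μ, ∀ t, t < k → model f lam (x t ω) (svrg f m x S b t ω) (x (t + 1) ω)
      ≤ model f lam (x t ω) (svrg f m x S b t ω) (x t ω) :=
    ae_all_iff.2 fun t => ae_all_iff.2 (hdec t)
  refine lintegral_mono_ae ?_
  filter_upwards [hall] with ω hω
  simp only [enorm_sq_eq_ofReal]
  rw [← ENNReal.ofReal_sum_of_nonneg fun _ _ => sq_nonneg _,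
    ← ENNReal.ofReal_sum_of_nonneg fun _ _ => sq_nonneg _, ← ENNReal.ofReal_mul (by positivity),
    ← ENNReal.ofReal_mul (by positivity), ← ENNReal.ofReal_add (gap_nonneg hbdd x₀)
      (mul_nonneg (by positivity) (Finset.sum_nonneg fun _ _ => sq_nonneg _))]
  refine ENNReal.ofReal_le_ofReal ?_
  have hsum := Finset.sum_le_sum fun t (ht : t ∈ Finset.range k) =>
    avg_le_of_model_le hf hED hlam (hω t (Finset.mem_range.1 ht))
  have htel := Finset.sum_range_sub (fun t => avg f (x t ω)) k
  have hinf : ⨅ z, avg f z ≤ avg f (x k ω) := ciInf_le hbdd _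
  simp only [Finset.sum_add_distrib, Finset.sum_sub_distrib, ← Finset.mul_sum, h.init] at hsum htel
  rw [gap]
  linarith

/-- The convergence estimate for the iterates of a run. -/
lemma IsRun.sum_lintegral_gradient_le [NeZero n] (h : IsRun μ m p x₀ 𝓕 x S b)
    [IsProbabilityMeasure μ] (hm : 1 ≤ m) (hmn : m ≤ n)
    {f : Fin n → Vec d → ℝ} (hf : ∀ i, Differentiable ℝ (f i))
    (hbdd : BddBelow (Set.range (avg f))) {Δ₁ δ : ℝ} (hΔ₁ : 0 < Δ₁) (hδ : 0 < δ)
    (hED : DelegateSimilar f Δ₁) (hSOD : AverageSimilar f δ) (hp : 0 < p) (hp1 : p ≤ 1)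
    {lam : ℝ} (hlam : lam = 3 * Δ₁ + 16 * deltaM n m δ / p) {T : ℕ}
    (hacc : SubproblemsAccurate μ f Δ₁ lam x₀ x (svrg f m x S b) T) :
    ∑ t ∈ Finset.range T, ∫⁻ ω, ‖gradient (avg f) (x (t + 1) ω)‖ₑ ^ 2 ∂μ
      ≤ ENNReal.ofReal (256 * (Δ₁ + 6 * deltaM n m δ / p) * gap f x₀) := by
  obtain ⟨hdec, hgrad⟩ := hacc
  have hF := gap_nonneg hbdd x₀
  have hσ : 0 ≤ deltaM n m δ := deltaM_nonneg hδ.le m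
  have hσp : 0 ≤ 16 * deltaM n m δ / p := by positivity
  have hlam1 : Δ₁ < lam := by rw [hlam]; linarith
  have ha : 0 < lam - Δ₁ := sub_pos.2 hlam1
  set σ := deltaM n m δ
  set F := gap f x₀
  set R : ℕ → ℝ≥0∞ := fun t => ∫⁻ ω, ‖x (t + 1) ω - x t ω‖ₑ ^ 2 ∂μ with hRdef
  set D : ℕ → ℝ≥0∞ := fun t => ∫⁻ ω, ‖x t ω - refPoint x b t ω‖ₑ ^ 2 ∂μ with hDdef
  set V : ℕ → ℝ≥0∞ :=
    fun t => ∫⁻ ω, ‖svrg f m x S b t ω - gradient (avg f) (x t ω)‖ₑ ^ 2 ∂μ with hVdef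
  set G : ℕ → ℝ≥0∞ := fun t =>
    ∫⁻ ω, ‖gradient (model f lam (x t ω) (svrg f m x S b t ω)) (x (t + 1) ω)‖ₑ ^ 2 ∂μ with hGdef
  set N : ℕ → ℝ≥0∞ := fun t => ∫⁻ ω, ‖gradient (avg f) (x (t + 1) ω)‖ₑ ^ 2 ∂μ with hNdef
  have hstep : ∀ k ≤ T, ENNReal.ofReal ((lam - Δ₁) / 4) * ∑ t ∈ Finset.range k, R t
      ≤ ENNReal.ofReal F + ENNReal.ofReal (1 / (lam - Δ₁)) * ∑ t ∈ Finset.range k, V t :=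
    fun k hk => h.lintegral_step_le hf hm hmn hbdd hED hlam1 fun t ht => hdec t (ht.trans_le hk)
  have hV : ∀ t, V t ≤ ENNReal.ofReal (σ ^ 2) * D t :=
    h.lintegral_svrg_error_le hp.le hf hm hmn hSOD
  have hD0 : D 0 = 0 := by simp [hDdef, refPoint]
  have hD : ∀ t, D (t + 1) ≤ ENNReal.ofReal (1 - p / 2) * D t + ENNReal.ofReal (2 / p) * R t :=
    h.lintegral_refPoint_dist_succ_le hp hp1
  have hN : ∀ t, N t ≤ 3 * (G t + V t + ENNReal.ofReal ((lam + Δ₁) ^ 2) * R t) := by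
    intro t
    simp only [hNdef, hGdef, hVdef, hRdef]
    rw [← lintegral_const_mul' _ _ ENNReal.ofReal_ne_top,
      ← lintegral_add_right' _ (h.aemeasurable_svrg_error hf hm hmn t),
      ← lintegral_add_right _ ((h.measurable_step_sq t).const_mul _),
      ← lintegral_const_mul' _ _ (by norm_num)]
    refine lintegral_mono fun ω => ?_
    simp only [enorm_sq_eq_ofReal]
    rw [← ENNReal.ofReal_mul (sq_nonneg _), ← ENNReal.ofReal_add (sq_nonneg _) (sq_nonneg _),
      ← ENNReal.ofReal_add (by positivity) (by positivity),
      ← ENNReal.ofReal_ofNat 3, ← ENNReal.ofReal_mul (by norm_num)]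
    exact ENNReal.ofReal_le_ofReal
      (norm_gradient_avg_sq_le hf hED (hΔ₁.trans hlam1).le _ _ _)
  -- Finiteness must precede the passage to reals, since `toReal` sends `∞` to `0`. It propagates
  -- from earlier steps to `D k`, then to `V k`, and to `R k` by the descent up to `k + 1`.
  have hfin : ∀ k ≤ T, ∀ t < k, R t ≠ ∞ ∧ D t ≠ ∞ ∧ V t ≠ ∞ := by
    intro k
    induction k with
    | zero => simp
    | succ k ih =>
      intro hk
      have ih := ih (by omega)
      have hDk : D k ≠ ∞ := by
        rcases k with _ | k
        · simp [hD0]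
        · have := ih k k.lt_succ_self
          exact ne_top_of_le_ne_top (ENNReal.add_ne_top.2
            ⟨ENNReal.mul_ne_top ENNReal.ofReal_ne_top this.2.1,
              ENNReal.mul_ne_top ENNReal.ofReal_ne_top this.1⟩) (hD k)
      have hVk : V k ≠ ∞ :=
        ne_top_of_le_ne_top (ENNReal.mul_ne_top ENNReal.ofReal_ne_top hDk) (hV k)
      have hVs : ∑ t ∈ Finset.range (k + 1), V t ≠ ∞ := by
        refine ENNReal.sum_ne_top.2 fun t ht => ?_
        rcases (Nat.lt_succ_iff.1 (Finset.mem_range.1 ht)).eq_or_lt with rfl | h'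
        · exact hVk
        · exact (ih t h').2.2
      have hRk : R k ≠ ∞ := by
        have h1 : ENNReal.ofReal ((lam - Δ₁) / 4) * ∑ t ∈ Finset.range (k + 1), R t ≠ ∞ :=
          ne_top_of_le_ne_top (ENNReal.add_ne_top.2 ⟨ENNReal.ofReal_ne_top,
            ENNReal.mul_ne_top ENNReal.ofReal_ne_top hVs⟩) (hstep (k + 1) hk)
        have h2 : ∑ t ∈ Finset.range (k + 1), R t ≠ ∞ := fun h3 => by
          rw [h3, ENNReal.mul_top (by simpa using hlam1)] at h1
          exact h1 rfl
        exact ENNReal.sum_ne_top.1 h2 k (Finset.self_mem_range_succ k)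
      intro t ht
      rcases (Nat.lt_succ_iff.1 ht).eq_or_lt with rfl | h'
      · exact ⟨hRk, hDk, hVk⟩
      · exact ih t h'
  have hfin := hfin T le_rfl
  have hVs : ∑ t ∈ Finset.range T, V t ≠ ∞ :=
    ENNReal.sum_ne_top.2 fun t ht => (hfin t (Finset.mem_range.1 ht)).2.2
  have hGs : ∑ t ∈ Finset.range T, G t ≠ ∞ :=
    ne_top_of_le_ne_top (ENNReal.add_ne_top.2 ⟨ENNReal.ofReal_ne_top, hVs⟩) hgrad
  have hGfin : ∀ t < T, G t ≠ ∞ := fun t ht =>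
    ENNReal.sum_ne_top.1 hGs t (Finset.mem_range.2 ht)
  have hNtop : ∀ t < T, 3 * (G t + V t + ENNReal.ofReal ((lam + Δ₁) ^ 2) * R t) ≠ ∞ := by
    intro t ht
    have := hfin t ht
    exact ENNReal.mul_ne_top (by norm_num) (ENNReal.add_ne_top.2 ⟨ENNReal.add_ne_top.2
      ⟨hGfin t ht, this.2.2⟩, ENNReal.mul_ne_top ENNReal.ofReal_ne_top this.1⟩)
  have hNfin : ∀ t < T, N t ≠ ∞ := fun t ht => ne_top_of_le_ne_top (hNtop t ht) (hN t)
  have toReal_sum : ∀ {u : ℕ → ℝ≥0∞}, (∀ t < T, u t ≠ ∞) →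
      ∑ t ∈ Finset.range T, (u t).toReal = (∑ t ∈ Finset.range T, u t).toReal :=
    fun hu => (ENNReal.toReal_sum fun t ht => hu t (Finset.mem_range.1 ht)).symm
  have hmain := sum_le_of_recursions hΔ₁ hσ hp hp1 hF hlam T
    (R := fun t => (R t).toReal) (D := fun t => (D t).toReal) (V := fun t => (V t).toReal)
    (G := fun t => (G t).toReal) (N := fun t => (N t).toReal)
    (fun _ => ENNReal.toReal_nonneg) (fun _ => ENNReal.toReal_nonneg) ?_ ?_ (by simp [hD0]) ?_ ?_ ?_
  · rw [toReal_sum hNfin] at hmain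
    exact (ENNReal.le_ofReal_iff_toReal_le (ENNReal.sum_ne_top.2 fun t ht =>
      hNfin t (Finset.mem_range.1 ht)) (ENNReal.toReal_nonneg.trans hmain)).2 hmain
  · rw [toReal_sum fun t ht => (hfin t ht).1, toReal_sum fun t ht => (hfin t ht).2.2]
    have := ENNReal.toReal_mono (ENNReal.add_ne_top.2 ⟨ENNReal.ofReal_ne_top,
      ENNReal.mul_ne_top ENNReal.ofReal_ne_top hVs⟩) (hstep T le_rfl)
    rwa [ENNReal.toReal_add ENNReal.ofReal_ne_top
      (ENNReal.mul_ne_top ENNReal.ofReal_ne_top hVs), ENNReal.toReal_mul, ENNReal.toReal_mul,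
      ENNReal.toReal_ofReal hF, ENNReal.toReal_ofReal (by positivity),
      ENNReal.toReal_ofReal (by positivity)] at this
  · intro t ht
    have := ENNReal.toReal_mono (ENNReal.mul_ne_top ENNReal.ofReal_ne_top (hfin t ht).2.1) (hV t)
    rwa [ENNReal.toReal_mul, ENNReal.toReal_ofReal (sq_nonneg _)] at this
  · intro t ht
    have hft := hfin t (by omega)
    have h1 := ENNReal.mul_ne_top (ENNReal.ofReal_ne_top (r := 1 - p / 2)) hft.2.1
    have h2 := ENNReal.mul_ne_top (ENNReal.ofReal_ne_top (r := 2 / p)) hft.1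
    have := ENNReal.toReal_mono (ENNReal.add_ne_top.2 ⟨h1, h2⟩) (hD t)
    rwa [ENNReal.toReal_add h1 h2, ENNReal.toReal_mul, ENNReal.toReal_mul,
      ENNReal.toReal_ofReal (by linarith), ENNReal.toReal_ofReal (by positivity)] at this
  · rw [toReal_sum hGfin, toReal_sum fun t ht => (hfin t ht).2.2]
    have := ENNReal.toReal_mono (ENNReal.add_ne_top.2 ⟨ENNReal.ofReal_ne_top, hVs⟩) hgrad
    rwa [ENNReal.toReal_add ENNReal.ofReal_ne_top hVs,
      ENNReal.toReal_ofReal (by positivity)] at this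
  · intro t ht
    have hft := hfin t ht
    have h1 := ENNReal.mul_ne_top (ENNReal.ofReal_ne_top (r := (lam + Δ₁) ^ 2)) hft.1
    have := ENNReal.toReal_mono (hNtop t ht) (hN t)
    rwa [ENNReal.toReal_mul, ENNReal.toReal_ofNat,
      ENNReal.toReal_add (ENNReal.add_ne_top.2 ⟨hGfin t ht, hft.2.2⟩) h1,
      ENNReal.toReal_add (hGfin t ht) hft.2.2, ENNReal.toReal_mul,
      ENNReal.toReal_ofReal (sq_nonneg _)] at this

end Run

end Stochastic
-- Communication cost and the uniformly sampled iterate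
section Conclusions

variable {n d : ℕ} {Ω : Type*}

lemma uses_append (s : Strategy) (R R' : List (Round n d)) :
    uses s (R ++ R') = uses s R + uses s R' :=
  List.countP_append

lemma uses_fullSync (s : Strategy) (m : ℕ) (w : Vec d) :
    uses s (fullSync n m w) = if s = .arbitrary then syncRounds n m else 0 := by
  unfold uses fullSync
  rw [List.countP_map]
  cases s <;> simp [Function.comp_def]

/-- The cost of the rounds of a run of the method. -/
lemma cost_runRounds [NeZero n] (CA CR : ℝ) (m : ℕ) (x g : ℕ → Ω → Vec d)
    (S : ℕ → Ω → Finset (Fin n)) (b : ℕ → Ω → Bool) (T : ℕ) (ω : Ω) :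
    CA * uses .arbitrary (runRounds m x g S b T ω) + CR * uses .random (runRounds m x g S b T ω)
        + uses .delegated (runRounds m x g S b T ω)
      = CA * syncRounds n m + ∑ t ∈ Finset.range T, (1 + if t = 0 then 0 else
          CR + {ω | b t ω = true}.indicator (fun _ => CA * syncRounds n m) ω) := by
  induction T with
  | zero => simp [runRounds, uses_fullSync]
  | succ T ih =>
    have hsucc : runRounds m x g S b (T + 1) ω
        = runRounds m x g S b T ω ++ iterationRounds m x g S b T ω := by
      simp [runRounds, List.range_succ, List.flatMap_append]
    have hiter : CA * uses .arbitrary (iterationRounds m x g S b T ω)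
        + CR * uses .random (iterationRounds m x g S b T ω)
        + uses .delegated (iterationRounds m x g S b T ω)
        = 1 + if T = 0 then 0 else
          CR + {ω | b T ω = true}.indicator (fun _ => CA * syncRounds n m) ω := by
      have hcons : ∀ s (r : Round n d) R, uses s (r :: R)
          = uses s R + if r.strategy = s then 1 else 0 := by
        intro s r R
        simp [uses, List.countP_cons]
      have hnil : ∀ s, uses s ([] : List (Round n d)) = 0 := fun s => rfl
      unfold iterationRounds
      by_cases hT : T = 0
      · simp [hT, hcons, hnil]
      · cases hb : b T ω <;> simp [hT, hcons, hnil, uses_append, uses_fullSync, hb] <;> ring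
    rw [hsucc, Finset.sum_range_succ, ← hiter, ← add_assoc, ← ih]
    simp only [uses_append]
    push_cast
    ring

variable [mΩ : MeasurableSpace Ω] {μ : Measure Ω}

/-- The expectation at a uniformly sampled index is the average of the expectations. -/
lemma lintegral_uniform_index [IsProbabilityMeasure μ] {E : Type*} [MeasurableSpace E]
    {x : ℕ → Ω → E} (hx : ∀ t, Measurable (x t)) {φ : E → ℝ≥0∞} (hφ : Measurable φ) {T : ℕ}
    {τ : Ω → ℕ} (hτ : Measurable τ) (hunif : μ.map τ = uniformOn (Set.Icc 1 T))
    (hind : IndepFun τ (fun ω t => x t ω) μ) :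
    ∫⁻ ω, φ (x (τ ω) ω) ∂μ
      = (T : ℝ≥0∞)⁻¹ * ∑ t ∈ Finset.range T, ∫⁻ ω, φ (x (t + 1) ω) ∂μ := by
  have hcoe : (Set.Icc 1 T) = ((Finset.Icc 1 T : Finset ℕ) : Set ℕ) := by simp
  rw [hcoe] at hunif
  have hmass : ∀ t ∈ Finset.Icc 1 T, μ (τ ⁻¹' {t}) = (T : ℝ≥0∞)⁻¹ := by
    intro t ht
    rw [← Measure.map_apply hτ (measurableSet_singleton t), hunif, ← Finset.coe_singleton,
      uniformOn_apply_finset, Finset.inter_singleton_of_mem ht]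
    simp
  have hae : ∀ᵐ ω ∂μ, τ ω ∈ Finset.Icc 1 T := by
    have h : ∀ᵐ t ∂(μ.map τ), t ∈ (Finset.Icc 1 T : Finset ℕ) := by
      rw [hunif]
      exact ae_cond_mem (Finset.measurableSet _)
    exact ae_of_ae_map hτ.aemeasurable h
  have hsplit : (fun ω => φ (x (τ ω) ω)) =ᵐ[μ]
      fun ω => ∑ t ∈ Finset.Icc 1 T, (τ ⁻¹' {t}).indicator 1 ω * φ (x t ω) := by
    filter_upwards [hae] with ω hω
    rw [Finset.sum_eq_single_of_mem (τ ω) hω]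
    · simp
    · intro t _ ht
      rw [Set.indicator_of_notMem (fun h => ht h.symm), zero_mul]
  have hterm : ∀ t ∈ Finset.Icc 1 T, ∫⁻ ω, (τ ⁻¹' {t}).indicator 1 ω * φ (x t ω) ∂μ
      = (T : ℝ≥0∞)⁻¹ * ∫⁻ ω, φ (x t ω) ∂μ := by
    intro t ht
    have h1 : Measurable (({t} : Set ℕ).indicator (1 : ℕ → ℝ≥0∞)) :=
      measurable_one.indicator (measurableSet_singleton t)
    have h2 : Measurable fun z : ℕ → E => φ (z t) := hφ.comp (measurable_pi_apply t)
    -- Independence of `τ` from the whole trajectory is restricted to the event `τ = t` and the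
    -- coordinate `t`.
    have h3 := lintegral_mul_eq_lintegral_mul_lintegral_of_indepFun (h1.comp hτ)
      (h2.comp (measurable_pi_lambda _ hx)) (hind.comp h1 h2)
    have h4 : ({t} : Set ℕ).indicator (1 : ℕ → ℝ≥0∞) ∘ τ = (τ ⁻¹' {t}).indicator 1 := rfl
    rw [h4] at h3
    refine Eq.trans h3 ?_
    rw [lintegral_indicator_one (hτ (measurableSet_singleton t)), hmass t ht]
    rfl
  rw [lintegral_congr_ae hsplit, lintegral_finsetSum, Finset.sum_congr rfl hterm, ← Finset.mul_sum,
    ← Finset.Ico_add_one_right_eq_Icc, Finset.sum_Ico_eq_sum_range, Nat.add_sub_cancel]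
  · simp only [add_comm 1]
  · exact fun t _ => (measurable_one.indicator (hτ (measurableSet_singleton t))).mul
      (hφ.comp (hx t))

/-- For `t ≥ 1` an iteration costs `1 + CR` surely and a synchronization with probability `p`, on
average another `CR` by `hp`. Iteration `0` costs only `1`. -/
lemma IsRun.commComplexity_le [NeZero n] [IsProbabilityMeasure μ] {m : ℕ} {p : ℝ} {x₀ : Vec d}
    {𝓕 : Filtration ℕ mΩ} {x : ℕ → Ω → Vec d} {S : ℕ → Ω → Finset (Fin n)} {b : ℕ → Ω → Bool}
    (h : IsRun μ m p x₀ 𝓕 x S b) (g : ℕ → Ω → Vec d) {CA CR : ℝ} (hCR : 0 ≤ CR) (hCA : 0 ≤ CA)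
    (hp : CA * syncRounds n m * p = CR) (T : ℕ) :
    commComplexity μ CA CR (runRounds m x g S b T)
      ≤ ENNReal.ofReal (CA * syncRounds n m + (2 * CR + 1) * T) := by
  unfold commComplexity
  simp_rw [cost_runRounds]
  set K : ℝ := CA * syncRounds n m with hK
  have hK0 : 0 ≤ K := by positivity
  have hind : ∀ t ω, 0 ≤ {ω | b t ω = true}.indicator (fun _ => K) ω :=
    fun t ω => Set.indicator_nonneg (fun _ _ => hK0) ω
  have hpos : ∀ t ω, 0 ≤ 1 + if t = 0 then 0 else
      CR + {ω | b t ω = true}.indicator (fun _ => K) ω := by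
    intro t ω
    have := hind t ω
    split_ifs <;> linarith
  have hmeas : ∀ t, Measurable fun ω => ENNReal.ofReal (1 + if t = 0 then 0 else
      CR + {ω | b t ω = true}.indicator (fun _ => K) ω) := by
    intro t
    split_ifs with ht
    · exact measurable_const
    · exact ((measurable_const.indicator (h.measurableSet_coin_eq (Nat.pos_of_ne_zero ht)
        true)).const_add CR |>.const_add 1).ennreal_ofReal
  have hterm : ∀ t ∈ Finset.range T, ∫⁻ ω, ENNReal.ofReal (1 + if t = 0 then 0 else
      CR + {ω | b t ω = true}.indicator (fun _ => K) ω) ∂μ ≤ ENNReal.ofReal (2 * CR + 1) := by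
    intro t _
    split_ifs with ht
    · simp only [add_zero, lintegral_const, measure_univ, mul_one]
      exact ENNReal.ofReal_le_ofReal (by linarith)
    · have ht : 1 ≤ t := Nat.pos_of_ne_zero ht
      have hpt : ∀ ω, ENNReal.ofReal (1 + (CR + {ω | b t ω = true}.indicator (fun _ => K) ω))
          = ENNReal.ofReal (1 + CR)
            + {ω | b t ω = true}.indicator (fun _ => ENNReal.ofReal K) ω := by
        intro ω
        rw [← add_assoc, ENNReal.ofReal_add (by positivity) (hind t ω)]
        by_cases hb : b t ω = true <;> simp [hb]
      simp_rw [hpt]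
      rw [lintegral_add_left measurable_const,
        lintegral_indicator_const (h.measurableSet_coin_eq ht true), h.coin_bernoulli t ht,
        lintegral_const, measure_univ, mul_one, ← ENNReal.ofReal_mul hK0, hp,
        ← ENNReal.ofReal_add (by positivity) hCR]
      exact ENNReal.ofReal_le_ofReal (by linarith)
  calc _ = ∫⁻ ω, (ENNReal.ofReal K + ∑ t ∈ Finset.range T, ENNReal.ofReal (1 + if t = 0 then 0 else
      CR + {ω | b t ω = true}.indicator (fun _ => K) ω)) ∂μ := by
        refine lintegral_congr fun ω => ?_
        rw [ENNReal.ofReal_add hK0 (Finset.sum_nonneg fun t _ => hpos t ω),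
          ENNReal.ofReal_sum_of_nonneg fun t _ => hpos t ω]
    _ = ENNReal.ofReal K + ∑ t ∈ Finset.range T, ∫⁻ ω, ENNReal.ofReal (1 + if t = 0 then 0 else
      CR + {ω | b t ω = true}.indicator (fun _ => K) ω) ∂μ := by
        rw [lintegral_add_left measurable_const, lintegral_finsetSum _ fun t _ => hmeas t,
          lintegral_const, measure_univ, mul_one]
    _ ≤ ENNReal.ofReal K + ∑ t ∈ Finset.range T, ENNReal.ofReal (2 * CR + 1) := by
        gcongr with t ht
        exact hterm t ht
    _ = _ := by
        rw [Finset.sum_const, Finset.card_range, nsmul_eq_mul, ← ENNReal.ofReal_natCast,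
          ← ENNReal.ofReal_mul (by positivity), ← ENNReal.ofReal_add hK0 (by positivity),
          mul_comm (T : ℝ)]

end Conclusions
end FedOpt

open FedOpt in
theorem mainTheorem12
    {n d : ℕ} [NeZero n] (m : ℕ) (hm : 1 ≤ m) (hmn : m ≤ n)
    (f : Fin n → Vec d → ℝ) (hf : ∀ i, Differentiable ℝ (f i))
    (hbdd : BddBelow (Set.range (avg f)))
    (Δ₁ δ : ℝ) (hΔ₁ : 0 < Δ₁) (hδ : 0 < δ)
    (hED : DelegateSimilar f Δ₁) (hSOD : AverageSimilar f δ)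
    (pB : ℝ) (hpB : 0 < pB) (hpB1 : pB ≤ 1)
    (ε : ℝ) (hε : 0 < ε) (x₀ : Vec d)
    (lam : ℝ) (hlam : lam = 3 * Δ₁ + 16 * deltaM n m δ / pB)
    (T : ℕ) (hT : T = ⌈256 * (Δ₁ + 6 * deltaM n m δ / pB) * gap f x₀ / ε ^ 2⌉₊)
    {Ω : Type*} [mΩ : MeasurableSpace Ω] (μ : Measure Ω) [IsProbabilityMeasure μ]
    (𝓕 : Filtration ℕ mΩ) (x : ℕ → Ω → Vec d) (S : ℕ → Ω → Finset (Fin n)) (b : ℕ → Ω → Bool)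
    (hrun : IsRun μ m pB x₀ 𝓕 x S b)
    (hacc : SubproblemsAccurate μ f Δ₁ lam x₀ x (svrg f m x S b) T) :
    (∀ τ : Ω → ℕ, Measurable τ → μ.map τ = uniformOn (Set.Icc 1 T) →
      IndepFun τ (fun ω t => x t ω) μ →
      ∫⁻ ω, ‖gradient (avg f) (x (τ ω) ω)‖ₑ ^ 2 ∂μ ≤ ENNReal.ofReal (ε ^ 2)) ∧
    (∀ CA CR : ℝ, 1 ≤ CR → CR ≤ CA → pB = CR / (CA * syncRounds n m) →
      commComplexity μ CA CR (runRounds m x (svrg f m x S b) S b T) ≤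
        ENNReal.ofReal (CA * syncRounds n m + (2 * CR + 1) *
          ⌈256 * (Δ₁ + 6 * deltaM n m δ * CA * syncRounds n m / CR) * gap f x₀ / ε ^ 2⌉₊)) := by
  have hF := gap_nonneg hbdd x₀
  have hσ : 0 ≤ deltaM n m δ := deltaM_nonneg hδ.le m
  constructor
  · intro τ hτ hunif hind
    -- For `T = 0` the uniform law on the empty set is the zero measure, which is not the law of any
    -- `τ`.
    have hT1 : T ≠ 0 := by
      rintro h0
      have := Measure.isProbabilityMeasure_map (μ := μ) hτ.aemeasurable
      rw [hunif, h0] at this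
      simpa using this.ne_zero
    have hTpos : (0 : ℝ) < T := by exact_mod_cast Nat.pos_of_ne_zero hT1
    rw [lintegral_uniform_index (φ := fun z => ‖gradient (avg f) z‖ₑ ^ 2) hrun.measurable_iterate
      ((measurable_gradient _).enorm.pow_const 2) hτ hunif hind]
    have hle : 256 * (Δ₁ + 6 * deltaM n m δ / pB) * gap f x₀ ≤ T * ε ^ 2 := by
      rw [← div_le_iff₀ (by positivity), hT]
      exact Nat.le_ceil _
    calc _ ≤ (T : ℝ≥0∞)⁻¹ * ENNReal.ofReal (T * ε ^ 2) := by
          gcongr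
          exact (hrun.sum_lintegral_gradient_le hm hmn hf hbdd hΔ₁ hδ hED hSOD hpB hpB1 hlam
            hacc).trans (ENNReal.ofReal_le_ofReal hle)
      _ = _ := by
          rw [ENNReal.ofReal_mul hTpos.le, ENNReal.ofReal_natCast, ← mul_assoc,
            ENNReal.inv_mul_cancel (by exact_mod_cast hT1) (ENNReal.natCast_ne_top _), one_mul]
  · intro CA CR hCR hCRA hp
    have hK : (0 : ℝ) < syncRounds n m := by
      have : 0 < syncRounds n m := Nat.ceil_pos.2 (div_pos
        (by exact_mod_cast hm.trans hmn) (by exact_mod_cast hm))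
      exact_mod_cast this
    have hCR0 : 0 < CR := by linarith
    have hCA0 : 0 < CA := by linarith
    have hpp : CA * syncRounds n m * pB = CR := by
      rw [hp]
      field_simp
    -- For this value of `pB` the ceiling in the bound is `T` itself.
    have hTeq : 6 * deltaM n m δ / pB = 6 * deltaM n m δ * CA * syncRounds n m / CR := by
      rw [hp]
      field_simp
    rw [← hTeq, ← hT]
    exact hrun.commComplexity_le _ hCR0.le hCA0.le hpp T
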